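/- \textbf{Theorem.} Let $W$ be a finite Coxeter group of rank $n$ acting on $\mathbb{R}^n$: that is, $W$ is a finite subgroup of the orthogonal group $O(n)$ with a Coxeter presentation \[ W = \langle s_1,\dots,s_n \mid (s_i s_j)^{m(i,j)} = 1 \rangle, \qquad m(i,i)=1,\quad m(i,j)=m(j,i)\ge 2 \ (i\neq j), \] on a set $S=\{s_1,\dots,s_n\}$ of $n$ generators (the simple reflections), each of which is the orthogonal reflection of $\mathbb{R}^n$ in a hyperplane $H_i$ through the origin. For each $i$ let $H_i^{+}$ be one of the two open half-spaces bounded by $H_i$, chosen arbitrarily. For $I\subseteq S$ let \[ C_I=\bigcap_{s_i\in I} H_i\ \cap \bigcap_{s_i\notin I} H_i^{+}, \] and let $W_I=\langle I\rangle$ be the standard parabolic subgroup of $W$ generated by the elements of $I$. If $|I|=n-1$, then the stabiliser of $C_I$ in $W$ is exactly the standard parabolic subgroup: \[ \{\,w\in W : w(C_I)=C_I\,\} = \langle I\rangle = W_I . \] -/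

import Mathlib

/-- The orthogonal group of Euclidean `n`-space: linear isometries of `ℝⁿ` onto itself. -/
abbrev OrthGroup (n : ℕ) : Type :=
  EuclideanSpace ℝ (Fin n) ≃ₗᵢ[ℝ] EuclideanSpace ℝ (Fin n)

/-- The hyperplane through the origin with normal vector `a` (a hyperplane when `a ≠ 0`). -/
noncomputable def mirror {n : ℕ} (a : EuclideanSpace ℝ (Fin n)) : Submodule ℝ (EuclideanSpace ℝ (Fin n)) :=
  (Submodule.span ℝ {a})ᗮ

/-- The reflection that negates `a` and fixes the hyperplane `mirror a` pointwise. -/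
noncomputable def mirrorReflection {n : ℕ} (a : EuclideanSpace ℝ (Fin n)) : OrthGroup n :=
  (Submodule.span ℝ {a})ᗮ.reflection

/-- The open half-space bounded by `mirror a`, on the side to which `a` points. -/
noncomputable def posHalfSpace {n : ℕ} (a : EuclideanSpace ℝ (Fin n)) : Set (EuclideanSpace ℝ (Fin n)) :=
  {x | 0 < inner ℝ a x}

/-- A finite Coxeter group of rank `n` acting on `ℝⁿ`: a finite subgroup `W` of the orthogonal
group with a Coxeter presentation on `n` generators (the simple reflections) `s i`, each of which
is a reflection of `ℝⁿ`. The vector `normal i` is a normal of the mirror of `s i`;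
its direction records which side of the mirror is called positive, and this choice is free. -/
structure FiniteCoxeterReflectionGroup (n : ℕ) where
  /-- The group. -/
  W : Subgroup (OrthGroup n)
  finite : Finite W
  /-- The orders `m(i, j)`. -/
  M : CoxeterMatrix (Fin n)
  /-- The presentation `⟨s i | (s i * s j) ^ m(i, j) = 1⟩` of `W`. -/
  cs : CoxeterSystem M W
  /-- Normal vectors of the mirrors. -/
  normal : Fin n → EuclideanSpace ℝ (Fin n)
  normal_ne_zero : ∀ i, normal i ≠ 0
  simple_eq : ∀ i, (cs.simple i : OrthGroup n) = mirrorReflection (normal i)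

namespace FiniteCoxeterReflectionGroup

variable {n : ℕ} (G : FiniteCoxeterReflectionGroup n)

open Classical in
/-- The facet `C_I`: the intersection over all `i` of the mirror `H_i` if `i ∈ I`, and of the
positive open half-space `H_i⁺` if `i ∉ I`. -/
noncomputable def facet (I : Finset (Fin n)) : Set (EuclideanSpace ℝ (Fin n)) :=
  ⋂ i, if i ∈ I then (mirror (G.normal i) : Set (EuclideanSpace ℝ (Fin n)))
    else posHalfSpace (G.normal i)

/-- The standard parabolic subgroup `W_I`, generated by the simple reflections `s i`, `i ∈ I`. -/
noncomputable def parabolic (I : Finset (Fin n)) : Subgroup G.W :=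
  Subgroup.closure (G.cs.simple '' (I : Set (Fin n)))

/-- The (setwise) stabiliser in `W` of a subset of `ℝⁿ`. -/
noncomputable def stab (C : Set (EuclideanSpace ℝ (Fin n))) : Subgroup G.W where
  carrier := {w | (w : OrthGroup n) '' C = C}
  one_mem' := by simp
  mul_mem' := by
    intro u v hu hv
    have hu' : (u : OrthGroup n) '' C = C := hu
    have hv' : (v : OrthGroup n) '' C = C := hv
    have h : ((u * v : G.W) : OrthGroup n) '' C
        = (u : OrthGroup n) '' ((v : OrthGroup n) '' C) := by
      rw [Set.image_image]; rfl
    change ((u * v : G.W) : OrthGroup n) '' C = C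
    rw [h, hv', hu']
  inv_mem' := by
    intro u hu
    have hu' : (u : OrthGroup n) '' C = C := hu
    change ((u⁻¹ : G.W) : OrthGroup n) '' C = C
    conv_lhs => rw [← hu']
    rw [Set.image_image]
    have : ∀ x, ((u⁻¹ : G.W) : OrthGroup n) ((u : OrthGroup n) x) = x :=
      fun x => (u : OrthGroup n).symm_apply_apply x
    simp only [this, Set.image_id']

end FiniteCoxeterReflectionGroup

/-!
An element `w` of `W` is a product of `codim Fix w` reflections of `W` whose roots are orthogonal
to `Fix w`: as `W` acts freely off the mirrors, `Fix w` lies in some mirror when `w ≠ 1`, and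
multiplying `w` by the reflection in such a mirror enlarges the fixed space.

Conversely, a product `c` of the distinct simple reflections `s i`, `i ∈ I`, cannot be written with
fewer than `|I|` reflections. A shortest factorization of `c` is a path from `c⁻¹` to `1` all of
whose steps multiply by reflections. Replacing its peaks by lower vertices, inside the dihedral
groups generated by two consecutive reflections, turns it into a path along which the Coxeter
length decreases; by strong exchange each step of that path deletes one letter of a word for `c⁻¹`.
This also shows that all reflections of a shortest factorization of `c` lie in `W_I`.

Comparing the two counts, `Fix c` is the intersection `L` of the mirrors `H_i`, `i ∈ I`. A
reflection whose root is orthogonal to `L` enlarges `Fix c`, hence occurs in a shortest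
factorization of `c` and lies in `W_I`; so `W_I` is the pointwise stabiliser of `L`. If
`|I| = n - 1`, then `L` is a line and `C_I` is an open ray in it, and an isometry that preserves a
ray fixes it pointwise.
-/

section StrongExchange

variable {ι W : Type*} [Group W] {M : CoxeterMatrix ι} (cs : CoxeterSystem M W)

open Classical in
/-- The action of a simple reflection on signed group elements: it conjugates `t` and switches the
sign of `(t, ε)` exactly when `t` is that simple reflection. -/
noncomputable def signedConjSimple (i : ι) : Equiv.Perm (W × ZMod 2) :=
  Function.Involutive.toPerm
    (fun p => (cs.simple i * p.1 * cs.simple i, p.2 + if p.1 = cs.simple i then 1 else 0)) <| by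
      rintro ⟨t, ε⟩
      have hfix : t * cs.simple i = 1 ↔ t = cs.simple i := by
        rw [mul_eq_one_iff_eq_inv, cs.inv_simple]
      simp [hfix, mul_assoc, add_assoc, CharTwo.add_self_eq_zero]

open Classical in
theorem signedConjSimple_apply (i : ι) (t : W) (ε : ZMod 2) :
    signedConjSimple cs i (t, ε) =
      (cs.simple i * t * cs.simple i, ε + if t = cs.simple i then 1 else 0) := rfl

open Classical in
theorem signedConjSimple_mul_pow_apply (i j : ι) (m : ℕ) (t : W) (ε : ZMod 2) :
    ((signedConjSimple cs i * signedConjSimple cs j) ^ m) (t, ε) =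
      ((cs.simple i * cs.simple j) ^ m * t * ((cs.simple i * cs.simple j) ^ m)⁻¹,
        ε + ∑ k ∈ Finset.range (2 * m),
          if t = cs.simple j * (cs.simple i * cs.simple j) ^ k then 1 else 0) := by
  set a := cs.simple i * cs.simple j with ha
  have hflip : ∀ k, cs.simple j * a ^ k = (a ^ k)⁻¹ * cs.simple j := fun k => by
    have : cs.simple j * a * (cs.simple j)⁻¹ = a⁻¹ := by simp [ha, mul_assoc]
    rw [← inv_pow, ← this, conj_pow, inv_mul_cancel_right]
  induction m with
  | zero => simp
  | succ m ih =>
    have hj : a ^ m * t * (a ^ m)⁻¹ = cs.simple j ↔ t = cs.simple j * a ^ (2 * m) := by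
      rw [two_mul, pow_add, ← mul_assoc, hflip, mul_inv_eq_iff_eq_mul, ← eq_inv_mul_iff_mul_eq,
        mul_assoc]
    have hi : cs.simple j * (a ^ m * t * (a ^ m)⁻¹) * cs.simple j = cs.simple i ↔
        t = cs.simple j * a ^ (2 * m + 1) := by
      have : cs.simple i = a * cs.simple j := by simp [ha]
      rw [this, mul_left_inj, ← eq_inv_mul_iff_mul_eq, cs.inv_simple, mul_inv_eq_iff_eq_mul,
        ← eq_inv_mul_iff_mul_eq, ← mul_assoc, ← mul_assoc, ← hflip, mul_assoc, mul_assoc,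
        ← pow_succ', ← pow_add]
      ring_nf
    rw [pow_succ', Equiv.Perm.mul_apply, Equiv.Perm.mul_apply, ih,
      show 2 * (m + 1) = 2 * m + 1 + 1 by ring, Finset.sum_range_succ,
      Finset.sum_range_succ]
    simp only [signedConjSimple_apply, hj, hi, Prod.mk.injEq]
    refine ⟨?_, by ring⟩
    simp only [pow_succ', mul_inv_rev, ha, cs.inv_simple, mul_assoc]

/-- On `(s_i s_j) ^ m(i, j)`, each `t = s_j (s_i s_j) ^ k` is met twice: for `k` and
`k + m(i, j)`. -/
theorem isLiftable_signedConjSimple : M.IsLiftable (signedConjSimple cs) := by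
  classical
  intro i j
  refine Equiv.ext fun ⟨t, ε⟩ => ?_
  rw [signedConjSimple_mul_pow_apply, two_mul, Finset.sum_range_add]
  simp only [pow_add, cs.simple_mul_simple_pow, one_mul, inv_one, mul_one, CharTwo.add_self_eq_zero,
    add_zero, Equiv.Perm.one_apply]

/-- The action of a Coxeter group on signed group elements extending `signedConjSimple`. -/
noncomputable def signedConj : W →* Equiv.Perm (W × ZMod 2) :=
  cs.lift ⟨_, isLiftable_signedConjSimple cs⟩

open Classical in
theorem signedConj_wordProd_apply (ω : List ι) (t : W) (ε : ZMod 2) :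
    signedConj cs (cs.wordProd ω) (t, ε) =
      (cs.wordProd ω * t * (cs.wordProd ω)⁻¹, ε + (cs.rightInvSeq ω).count t) := by
  induction ω with
  | nil => simp
  | cons i ω ih =>
    have hhead : cs.wordProd ω * t * (cs.wordProd ω)⁻¹ = cs.simple i ↔
        (cs.wordProd ω)⁻¹ * cs.simple i * cs.wordProd ω = t := by
      rw [mul_inv_eq_iff_eq_mul, ← eq_inv_mul_iff_mul_eq, eq_comm, mul_assoc]
    rw [cs.wordProd_cons, map_mul, Equiv.Perm.mul_apply, ih, signedConj,
      cs.lift_apply_simple, signedConjSimple_apply, CoxeterSystem.rightInvSeq, List.count_cons,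
      if_congr hhead rfl rfl]
    simp [mul_assoc, add_assoc]

/-- The parity of the number of occurrences of `t` in the right inversion sequence of any word
for `w`. -/
noncomputable def inversionParity (w t : W) : ZMod 2 := (signedConj cs w (t, 0)).2

open Classical in
theorem inversionParity_wordProd (ω : List ι) (t : W) :
    inversionParity cs (cs.wordProd ω) t = (cs.rightInvSeq ω).count t := by
  simp [inversionParity, signedConj_wordProd_apply]

theorem signedConj_apply (w t : W) (ε : ZMod 2) :
    signedConj cs w (t, ε) = (w * t * w⁻¹, ε + inversionParity cs w t) := by
  classical
  obtain ⟨ω, rfl⟩ := cs.wordProd_surjective w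
  rw [signedConj_wordProd_apply, inversionParity_wordProd]

theorem inversionParity_one (t : W) : inversionParity cs 1 t = 0 := by
  simp [inversionParity]

theorem inversionParity_mul (u v t : W) :
    inversionParity cs (u * v) t =
      inversionParity cs v t + inversionParity cs u (v * t * v⁻¹) := by
  rw [inversionParity, map_mul, Equiv.Perm.mul_apply, signedConj_apply cs v,
    signedConj_apply, zero_add]

open Classical in
theorem inversionParity_simple (i : ι) (t : W) :
    inversionParity cs (cs.simple i) t = if t = cs.simple i then 1 else 0 := by
  simp [inversionParity, signedConj, signedConjSimple_apply]

theorem inversionParity_self {t : W} (ht : cs.IsReflection t) : inversionParity cs t t = 1 := by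
  obtain ⟨u, i, rfl⟩ := ht
  have hcancel := inversionParity_mul cs u u⁻¹ (u * cs.simple i * u⁻¹)
  have hconj : u⁻¹ * (u * cs.simple i * u⁻¹) * u⁻¹⁻¹ = cs.simple i := by group
  rw [mul_inv_cancel, inversionParity_one, hconj] at hcancel
  rw [inversionParity_mul, inversionParity_mul, hconj, mul_inv_cancel_right,
    inversionParity_simple, if_pos rfl, add_left_comm, ← hcancel, add_zero]

theorem mem_rightInvSeq_of_inversionParity_eq_one {ω : List ι} {t : W}
    (h : inversionParity cs (cs.wordProd ω) t = 1) : t ∈ cs.rightInvSeq ω := by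
  classical
  by_contra hmem
  rw [inversionParity_wordProd, List.count_eq_zero_of_not_mem hmem] at h
  exact zero_ne_one h

theorem isRightInversion_iff_inversionParity {t : W} (ht : cs.IsReflection t) {w : W} :
    cs.IsRightInversion w t ↔ inversionParity cs w t = 1 := by
  have of_parity : ∀ v, inversionParity cs v t = 1 → cs.IsRightInversion v t := by
    intro v hv
    obtain ⟨ω, hω, rfl⟩ := cs.exists_isReduced v
    exact cs.isRightInversion_of_mem_rightInvSeq hω
      (mem_rightInvSeq_of_inversionParity_eq_one cs hv)
  refine ⟨fun hw => ?_, of_parity w⟩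
  by_contra h
  refine ht.isRightInversion_mul_left_iff.mp (of_parity (w * t) ?_) hw
  have hzero : inversionParity cs w t = 0 := by
    generalize inversionParity cs w t = p at h
    decide +revert
  rw [inversionParity_mul, inversionParity_self cs ht, mul_inv_cancel_right, hzero, add_zero]

theorem strong_exchange {ω : List ι} {t : W} (h : cs.IsRightInversion (cs.wordProd ω) t) :
    ∃ k < ω.length, cs.wordProd ω * t = cs.wordProd (ω.eraseIdx k) := by
  obtain ⟨k, hk, rfl⟩ := List.getElem_of_mem (mem_rightInvSeq_of_inversionParity_eq_one cs
    ((isRightInversion_iff_inversionParity cs h.1).mp h))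
  refine ⟨k, by simpa using hk, ?_⟩
  rw [← cs.wordProd_mul_getD_rightInvSeq, List.getD_eq_getElem]

end StrongExchange

section SimpleInjective

theorem reflection_mul_reflection_pow_eq_one_of_odd {E : Type*} [AddCommGroup E] [Module ℝ E]
    {x y : E} {f g : Module.Dual ℝ E} (hf : f x = 2) (hg : g y = 2) {m : ℕ} (hodd : Odd m)
    (hm : m ≠ 1) (hfy : f y = -2 * Real.cos (Real.pi / m))
    (hgx : g x = -2 * Real.cos (Real.pi / m)) :
    (Module.reflection hf * Module.reflection hg) ^ m = 1 := by
  obtain ⟨k, rfl⟩ := hodd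
  set θ := Real.pi / (2 * k + 1 : ℕ) with hθ
  have hkθ : (2 * k + 1) * θ = Real.pi := by
    rw [hθ]
    push_cast
    field_simp
  have hsin : Real.sin (2 * θ) ≠ 0 := by
    have hk : (1 : ℝ) ≤ k := by exact_mod_cast (by omega : 1 ≤ k)
    have hθ_pos : 0 < θ := by positivity
    exact (Real.sin_pos_of_pos_of_lt_pi (by linarith) (by nlinarith)).ne'
  have hcartan : 2 * Real.cos (2 * θ) = f y * g x - 2 := by
    rw [hfy, hgx, Real.cos_two_mul]
    ring
  have hS : (Polynomial.Chebyshev.S ℝ (k : ℤ)).eval (2 * Real.cos (2 * θ)) +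
      (Polynomial.Chebyshev.S ℝ ((k : ℤ) - 1)).eval (2 * Real.cos (2 * θ)) = 0 := by
    refine (mul_eq_zero.mp (?_ : _ * Real.sin (2 * θ) = 0)).resolve_right hsin
    rw [add_mul, Polynomial.Chebyshev.S_two_mul_real_cos,
      Polynomial.Chebyshev.S_two_mul_real_cos,
      show (((k : ℤ) : ℝ) + 1) * (2 * θ) = θ + Real.pi by rw [← hkθ]; push_cast; ring,
      show ((((k : ℤ) - 1 : ℤ) : ℝ) + 1) * (2 * θ) = Real.pi - θ by rw [← hkθ]; push_cast; ring,
      Real.sin_pi_sub, Real.sin_add_pi, neg_add_cancel]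
  ext z
  rw [Module.reflection_mul_reflection_pow_apply hf hg _ z _ hcartan,
    show (((2 * k + 1 : ℕ) : ℤ) - 2) / 2 = k - 1 by omega,
    show (((2 * k + 1 : ℕ) : ℤ) - 1) / 2 = k by omega,
    show (((2 * k + 1 : ℕ) : ℤ) - 3) / 2 = k - 1 by omega,
    show ((2 * k + 1 : ℕ) : ℤ) / 2 = k by omega, hS]
  simp

variable {ι : Type*} (M : CoxeterMatrix ι)

open Classical in
/-- The Cartan matrix of `M` with every even entry of `M` replaced by `2`. Since `2` divides every
even number, its reflections still satisfy the relations of `M`, and they are pairwise distinct. -/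
noncomputable def oddCartan (k l : ι) : ℝ :=
  if Even (M k l) then 0 else -2 * Real.cos (Real.pi / M k l)

theorem linearCombination_oddCartan_single (k l : ι) :
    Finsupp.linearCombination ℝ (oddCartan M k) (Finsupp.single l 1) = oddCartan M k l := by
  simp

theorem linearCombination_oddCartan_single_self (k : ι) :
    Finsupp.linearCombination ℝ (oddCartan M k) (Finsupp.single k 1) = 2 := by
  simp [oddCartan]

/-- The reflections of `ι →₀ ℝ` with Cartan matrix `oddCartan M`. -/
noncomputable def oddReflection (k : ι) : (ι →₀ ℝ) ≃ₗ[ℝ] (ι →₀ ℝ) :=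
  Module.reflection (linearCombination_oddCartan_single_self M k)

theorem oddReflection_mul_self (k : ι) : oddReflection M k * oddReflection M k = 1 :=
  LinearEquiv.ext (Module.involutive_reflection (linearCombination_oddCartan_single_self M k))

theorem isLiftable_oddReflection : M.IsLiftable (oddReflection M) := by
  intro i j
  rcases eq_or_ne i j with rfl | hij
  · rw [M.diagonal, pow_one, oddReflection_mul_self]
  by_cases heven : Even (M i j)
  · have hcomm : Commute (oddReflection M i) (oddReflection M j) := by
      refine LinearEquiv.ext fun v => ?_
      simp only [LinearEquiv.mul_apply, oddReflection, Module.reflection_apply, map_sub, map_smul,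
        linearCombination_oddCartan_single, oddCartan, M.symmetric j i, if_pos heven, zero_smul,
        sub_zero]
      abel
    obtain ⟨q, hq⟩ := even_iff_two_dvd.mp heven
    rw [hq, pow_mul, hcomm.mul_pow, pow_two, pow_two, oddReflection_mul_self,
      oddReflection_mul_self, mul_one, one_pow]
  · refine reflection_mul_reflection_pow_eq_one_of_odd _ _ (Nat.not_even_iff_odd.mp heven)
      (M.off_diagonal i j hij) ?_ ?_
    · rw [linearCombination_oddCartan_single, oddCartan, if_neg heven]
    · rw [linearCombination_oddCartan_single, oddCartan, M.symmetric j i, if_neg heven]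

theorem oddReflection_injective : Function.Injective (oddReflection M) := by
  intro i j hij
  by_contra hne
  have h := DFunLike.congr_fun (LinearEquiv.congr_fun hij (Finsupp.single i 1)) i
  norm_num [oddReflection, Module.reflection_apply, hne] at h

variable {W : Type*} [Group W] {M} (cs : CoxeterSystem M W)

theorem coxeterSystem_simple_injective : Function.Injective cs.simple := by
  intro i j hij
  refine oddReflection_injective M ?_
  rw [← cs.lift_apply_simple (isLiftable_oddReflection M) i, hij, cs.lift_apply_simple]

theorem eq_nil_of_wordProd_eq_one (ω : List ι) (hω : ω.Nodup) (h : cs.wordProd ω = 1) :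
    ω = [] := by
  match ω with
  | [] => rfl
  | i :: ω =>
    obtain ⟨hi, hω⟩ := List.nodup_cons.mp hω
    have hprod : cs.wordProd ω = cs.simple i := by
      rw [cs.wordProd_cons, mul_eq_one_iff_inv_eq, cs.inv_simple] at h
      exact h.symm
    have hinv : cs.IsRightInversion (cs.wordProd ω) (cs.simple i) :=
      ⟨cs.isReflection_simple i, by simp [hprod]⟩
    obtain ⟨k, hk, hexchange⟩ := strong_exchange cs hinv
    rw [hprod, cs.simple_mul_simple_self] at hexchange
    have herase := eq_nil_of_wordProd_eq_one _ (hω.sublist (ω.eraseIdx_sublist k)) hexchange.symm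
    have hlength : ω.length = 1 := by
      have := List.length_eraseIdx_of_lt hk
      rw [herase, List.length_nil] at this
      omega
    obtain ⟨j, rfl⟩ := List.length_eq_one_iff.mp hlength
    rw [cs.wordProd_singleton] at hprod
    exact absurd (coxeterSystem_simple_injective cs hprod) (by simpa [eq_comm] using hi)
termination_by ω.length
decreasing_by simp [List.length_eraseIdx_of_lt hk]

end SimpleInjective

section ReflectionFactorizations

variable {ι W : Type*} [Group W] {M : CoxeterMatrix ι} {cs : CoxeterSystem M W}

section Dihedral

variable {t a : W}

theorem mul_zpow_eq_zpow_neg_mul (ht : cs.IsReflection t) (hat : cs.IsReflection (a * t)) (k : ℤ) :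
    t * a ^ k = a ^ (-k) * t := by
  have hsemi : SemiconjBy t a⁻¹ a := by
    have h := hat.inv
    rwa [mul_inv_rev, ht.inv] at h
  simpa [inv_zpow'] using (hsemi.zpow_right (-k)).eq

theorem conj_zpow_mul_eq (ht : cs.IsReflection t) (hat : cs.IsReflection (a * t)) (k : ℤ) :
    a * (a ^ k * t) * a⁻¹ = a ^ (k + 2) * t := by
  have h := mul_zpow_eq_zpow_neg_mul ht hat (-1)
  rw [zpow_neg_one, neg_neg, zpow_one] at h
  rw [mul_assoc, mul_assoc, h, ← mul_assoc, ← mul_assoc, ← zpow_one_add, ← zpow_add_one,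
    show 1 + k + 1 = k + 2 by ring]

theorem isReflection_zpow_mul (ht : cs.IsReflection t) (hat : cs.IsReflection (a * t)) (k : ℤ) :
    cs.IsReflection (a ^ k * t) := by
  have hconj : ∀ m : ℤ, t * (a ^ m)⁻¹ = a ^ m * t := fun m => by
    rw [← zpow_neg, mul_zpow_eq_zpow_neg_mul ht hat, neg_neg]
  obtain ⟨m, rfl | rfl⟩ := Int.even_or_odd' k
  · have h := ht.conj (a ^ m)
    rwa [mul_assoc, hconj, ← mul_assoc, ← zpow_add, ← two_mul] at h
  · have h := hat.conj (a ^ m)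
    rwa [mul_assoc, mul_assoc, hconj, ← mul_assoc a, ← mul_assoc, ← zpow_one_add, ← zpow_add,
      show m + (1 + m) = 2 * m + 1 by ring] at h

theorem eq_one_of_inversionParity_eq_zero_of_simple (hat : cs.IsReflection (a * t)) {i : ι}
    (hi : t = cs.simple i)
    (h : ∀ k : ℤ, inversionParity cs a (a ^ k * t) = 0) : a = 1 := by
  have ht : cs.IsReflection t := hi ▸ cs.isReflection_simple i
  have hself := inversionParity_self cs hat
  have hconj : t * (a * t) * t⁻¹ = a ^ (-1 : ℤ) * t := by
    have := mul_zpow_eq_zpow_neg_mul ht hat 1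
    rw [zpow_one] at this
    rw [← mul_assoc, this, mul_inv_cancel_right]
  rw [inversionParity_mul, hconj, h, add_zero, hi, inversionParity_simple, ← hi] at hself
  by_contra hne
  rw [if_neg (by simpa using hne)] at hself
  exact zero_ne_one hself

/-- If no reflection `a ^ k * t` is simple, then conjugating `a` and `t` by the first letter of a
palindromic word for `t` preserves the hypotheses and shortens the word. -/
theorem eq_one_of_inversionParity_eq_zero (ht : cs.IsReflection t) (hat : cs.IsReflection (a * t))
    (h : ∀ k : ℤ, inversionParity cs a (a ^ k * t) = 0) : a = 1 := by
  obtain ⟨u, i, rfl⟩ := ht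
  obtain ⟨ω, rfl⟩ := cs.wordProd_surjective u
  induction ω generalizing a with
  | nil => exact eq_one_of_inversionParity_eq_zero_of_simple hat (i := i) (by simp) h
  | cons j ω ih =>
    set t := cs.wordProd (j :: ω) * cs.simple i * (cs.wordProd (j :: ω))⁻¹ with ht_def
    have ht : cs.IsReflection t := ⟨_, _, rfl⟩
    by_cases hsimple : ∃ k : ℤ, a ^ k * t = cs.simple j
    · obtain ⟨k, hk⟩ := hsimple
      refine eq_one_of_inversionParity_eq_zero_of_simple ?_ hk fun l => ?_
      · rw [← mul_assoc, ← zpow_one_add]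
        exact isReflection_zpow_mul ht hat _
      · rw [← mul_assoc, ← zpow_add]
        exact h _
    push Not at hsimple
    set s := cs.simple j with hs
    have hconj : cs.wordProd ω * cs.simple i * (cs.wordProd ω)⁻¹ = s * t * s⁻¹ := by
      simp [ht_def, hs, cs.wordProd_cons, mul_assoc]
    have hrefl : ∀ k : ℤ, (s * a * s⁻¹) ^ k * (s * t * s⁻¹) = s * (a ^ k * t) * s⁻¹ := fun k => by
      rw [conj_zpow]
      group
    refine conj_eq_one_iff.mp (ih (a := s * a * s⁻¹) ?_ fun k => ?_)
    · rw [hconj]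
      have h1 := hrefl 1
      rw [zpow_one, zpow_one] at h1
      exact h1 ▸ hat.conj s
    · have hback : s⁻¹ * (s * (a ^ k * t) * s⁻¹) * s⁻¹⁻¹ = a ^ k * t := by group
      have hne : s * (a ^ k * t) * s⁻¹ ≠ s := fun heq => hsimple k (by
        rwa [mul_inv_eq_iff_eq_mul, mul_right_inj] at heq)
      rw [hconj, hrefl, inversionParity_mul, hback, inversionParity_mul, h,
        conj_zpow_mul_eq ht hat, hs, cs.inv_simple, inversionParity_simple, inversionParity_simple,
        ← hs, if_neg (hsimple _),
        if_neg (by rwa [hs, cs.inv_simple, ← hs] at hne), add_zero, add_zero]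

end Dihedral

variable {x t t' : W}

theorem isReflection_mul_mul (ht : cs.IsReflection t) (ht' : cs.IsReflection t') :
    cs.IsReflection (t * t' * t) := by
  have h := ht'.conj t
  rwa [ht.inv] at h

theorem exists_length_mul_zpow_lt (ht : cs.IsRightInversion x t) (ht' : cs.IsRightInversion x t')
    (hne : t ≠ t') : ∃ k : ℤ, cs.length (x * (t * t') ^ k) < cs.length x := by
  by_contra! hle
  have hat := isReflection_mul_mul ht.1 ht'.1
  have hta : t * (t * t') = t' := by rw [← mul_assoc, ht.1.mul_self, one_mul]
  set a := t * t'
  have hzero : ∀ j k : ℤ, cs.length (x * (t * a ^ j)) < cs.length x →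
      inversionParity cs (x * (t * a ^ j)) (a ^ k * t) = 0 := by
    intro j k hj
    have hrot : x * (t * a ^ j) * (a ^ k * t) = x * a ^ (-(j + k)) := by
      have h := mul_zpow_eq_zpow_neg_mul ht.1 hat (j + k)
      rw [mul_assoc x, mul_assoc t, ← mul_assoc (a ^ j), ← zpow_add, ← mul_assoc t, h, mul_assoc,
        ht.1.mul_self, mul_one]
    have hinv : ¬ cs.IsRightInversion (x * (t * a ^ j)) (a ^ k * t) := fun h =>
      (h.2.trans hj).not_ge (hrot ▸ hle _)
    rw [isRightInversion_iff_inversionParity cs (isReflection_zpow_mul ht.1 hat k)] at hinv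
    generalize inversionParity cs (x * (t * a ^ j)) (a ^ k * t) = p at hinv
    decide +revert
  have ha_one : a = 1 := by
    refine eq_one_of_inversionParity_eq_zero ht.1 hat fun k => ?_
    have h1 := hzero 1 k (by rw [zpow_one, hta]; exact ht'.2)
    have h0 := hzero 0 (k + 2) (by rw [zpow_zero, mul_one]; exact ht.2)
    rw [zpow_zero, mul_one] at h0
    rwa [zpow_one, ← mul_assoc, inversionParity_mul, conj_zpow_mul_eq ht.1 hat, h0,
      add_zero] at h1
  exact hne (by rw [← hta, ha_one, mul_one])

theorem exists_reflections_mul_eq_length_lt (ht : cs.IsRightInversion x t)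
    (ht' : cs.IsRightInversion x t') (hne : t ≠ t') :
    ∃ r r', cs.IsReflection r ∧ cs.IsReflection r' ∧ r * r' = t * t' ∧
      t ∈ Subgroup.closure {r, r'} ∧ t' ∈ Subgroup.closure {r, r'} ∧
      cs.length (x * t * r) < cs.length x := by
  have hat := isReflection_mul_mul ht.1 ht'.1
  have hta : t * (t * t') = t' := by rw [← mul_assoc, ht.1.mul_self, one_mul]
  obtain ⟨k, hk⟩ := exists_length_mul_zpow_lt ht ht' hne
  generalize t * t' = a at hat hta hk ⊢
  obtain ⟨r, hr⟩ : ∃ r, r = t * a ^ k := ⟨_, rfl⟩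
  obtain ⟨r', hr'⟩ : ∃ r', r' = t * a ^ (k + 1) := ⟨_, rfl⟩
  have hr_refl : cs.IsReflection r := by
    rw [hr, mul_zpow_eq_zpow_neg_mul ht.1 hat]
    exact isReflection_zpow_mul ht.1 hat _
  have hr'_refl : cs.IsReflection r' := by
    rw [hr', mul_zpow_eq_zpow_neg_mul ht.1 hat]
    exact isReflection_zpow_mul ht.1 hat _
  have hrr' : r * r' = a := by
    rw [show r' = r * a by rw [hr, hr', zpow_add_one, mul_assoc], ← mul_assoc, hr_refl.mul_self,
      one_mul]
  have hr_mem : r ∈ Subgroup.closure {r, r'} := Subgroup.subset_closure (by simp)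
  have ha_mem : a ∈ Subgroup.closure {r, r'} :=
    hrr' ▸ mul_mem hr_mem (Subgroup.subset_closure (by simp))
  have ht_mem : t ∈ Subgroup.closure {r, r'} := by
    rw [eq_mul_inv_of_mul_eq hr.symm]
    exact mul_mem hr_mem (inv_mem (zpow_mem ha_mem k))
  refine ⟨r, r', hr_refl, hr'_refl, hrr', ht_mem, hta ▸ mul_mem ht_mem ha_mem, ?_⟩
  rwa [hr, mul_assoc, ← mul_assoc t, ht.1.mul_self, one_mul]

variable (cs) in
/-- The smallest number of reflections with product `w`. -/
noncomputable def reflectionLength (w : W) : ℕ :=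
  sInf {k | ∃ L : List W, L.length = k ∧ (∀ t ∈ L, cs.IsReflection t) ∧ L.prod = w}

theorem reflectionLength_prod_le {L : List W} (hL : ∀ t ∈ L, cs.IsReflection t) :
    reflectionLength cs L.prod ≤ L.length :=
  Nat.sInf_le ⟨L, rfl, hL, rfl⟩

variable (cs) in
theorem exists_length_eq_reflectionLength (w : W) :
    ∃ L : List W, L.length = reflectionLength cs w ∧ (∀ t ∈ L, cs.IsReflection t) ∧ L.prod = w := by
  refine Nat.sInf_mem
    (s := {k | ∃ L : List W, L.length = k ∧ (∀ t ∈ L, cs.IsReflection t) ∧ L.prod = w}) ?_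
  obtain ⟨ω, rfl⟩ := cs.wordProd_surjective w
  exact ⟨_, ω.map cs.simple, rfl, by simp [cs.isReflection_simple], rfl⟩

variable (cs) in
/-- The sum of the lengths of all vertices of the path `w, w t₁, w t₁ t₂, …`. -/
noncomputable def pathLengthSum (w : W) : List W → ℕ
  | [] => cs.length w
  | t :: L => cs.length w + pathLengthSum (w * t) L

variable (cs) in
/-- Along the path `w, w t₁, w t₁ t₂, …` the length strictly decreases. -/
def IsDescendingPath (w : W) : List W → Prop
  | [] => True
  | t :: L => cs.length (w * t) < cs.length w ∧ IsDescendingPath (w * t) L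

theorem pathLengthSum_append_cons_cons_lt {w r r' : W} {L₁ L₂ : List W}
    (hprod : r * r' = t * t')
    (hlt : cs.length (w * L₁.prod * r) < cs.length (w * L₁.prod * t)) :
    pathLengthSum cs w (L₁ ++ r :: r' :: L₂) < pathLengthSum cs w (L₁ ++ t :: t' :: L₂) := by
  induction L₁ generalizing w with
  | nil =>
    simp only [List.prod_nil, mul_one] at hlt
    simp only [List.nil_append, pathLengthSum, mul_assoc, hprod]
    omega
  | cons u L₁ ih =>
    simp only [List.cons_append, pathLengthSum, add_lt_add_iff_left]
    exact ih (by simpa only [List.prod_cons, ← mul_assoc] using hlt)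

theorem exists_peak_of_not_isDescendingPath {w : W} {L : List W}
    (hL : ∀ t ∈ L, cs.IsReflection t) (hprod : w * L.prod = 1) (h : ¬ IsDescendingPath cs w L) :
    ∃ L₁ t t' L₂, L = L₁ ++ t :: t' :: L₂ ∧
      cs.IsRightInversion (w * L₁.prod * t) t ∧ cs.IsRightInversion (w * L₁.prod * t) t' := by
  induction L generalizing w with
  | nil => exact absurd trivial h
  | cons t L ih =>
    obtain ⟨ht, hL⟩ := List.forall_mem_cons.mp hL
    rw [List.prod_cons, ← mul_assoc] at hprod
    by_cases hdesc : IsDescendingPath cs (w * t) L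
    · have hup : cs.length w < cs.length (w * t) :=
        (not_lt.mp fun hlt => h ⟨hlt, hdesc⟩).lt_of_ne (ht.length_mul_left_ne w).symm
      match L with
      | [] =>
        rw [List.prod_nil, mul_one] at hprod
        simp [hprod] at hup
      | t' :: L =>
        refine ⟨[], t, t', L, rfl, ⟨ht, ?_⟩, hL t' (by simp), ?_⟩
        · simpa [mul_assoc, ht.mul_self] using hup
        · simpa using hdesc.1
    · obtain ⟨L₁, u, u', L₂, rfl, hu, hu'⟩ := ih hL hprod hdesc
      exact ⟨t :: L₁, u, u', L₂, rfl, by simpa only [List.prod_cons, ← mul_assoc] using hu,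
        by simpa only [List.prod_cons, ← mul_assoc] using hu'⟩

/-- Each peak of the path is replaced by a lower vertex until none is left. -/
theorem exists_isDescendingPath {w : W} (L : List W) (hL : ∀ t ∈ L, cs.IsReflection t)
    (hprod : w * L.prod = 1) (hmin : L.length = reflectionLength cs L.prod) :
    ∃ L' : List W, (∀ t ∈ L', cs.IsReflection t) ∧ L'.prod = L.prod ∧ L'.length = L.length ∧
      (∀ t ∈ L, t ∈ Subgroup.closure {r | r ∈ L'}) ∧ IsDescendingPath cs w L' := by
  by_cases h : IsDescendingPath cs w L
  · exact ⟨L, hL, rfl, rfl, fun t ht => Subgroup.subset_closure ht, h⟩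
  obtain ⟨L₁, t, t', L₂, rfl, ht, ht'⟩ := exists_peak_of_not_isDescendingPath hL hprod h
  have hne : t ≠ t' := by
    rintro rfl
    have hcancel : (L₁ ++ t :: t :: L₂).prod = (L₁ ++ L₂).prod := by
      simp [← mul_assoc t, ht.1.mul_self]
    have hshort := reflectionLength_prod_le (cs := cs) (L := L₁ ++ L₂) fun r hr => hL r (by
      simp only [List.mem_append, List.mem_cons] at hr ⊢
      tauto)
    rw [← hcancel, ← hmin] at hshort
    simp at hshort
  obtain ⟨r, r', hr, hr', hrr', ht_mem, ht'_mem, hlt⟩ :=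
    exists_reflections_mul_eq_length_lt ht ht' hne
  have hprod' : (L₁ ++ r :: r' :: L₂).prod = (L₁ ++ t :: t' :: L₂).prod := by
    simp [← mul_assoc r, ← mul_assoc t, hrr']
  rw [mul_assoc _ t t, ht.1.mul_self, mul_one] at hlt
  have hdecreasing := pathLengthSum_append_cons_cons_lt (L₂ := L₂) hrr' hlt
  obtain ⟨L', hL', hprod_eq, hlength, hmem, hdesc⟩ :=
    exists_isDescendingPath (L₁ ++ r :: r' :: L₂) (fun u hu => by
      simp only [List.mem_append, List.mem_cons] at hL hu
      rcases hu with hu | rfl | rfl | hu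
      exacts [hL u (by tauto), hr, hr', hL u (by tauto)])
      (hprod' ▸ hprod) (by rw [hprod', ← hmin]; simp)
  have hpair : Subgroup.closure {r, r'} ≤ Subgroup.closure {u | u ∈ L'} := by
    rw [Subgroup.closure_le, Set.insert_subset_iff, Set.singleton_subset_iff]
    exact ⟨hmem r (by simp), hmem r' (by simp)⟩
  refine ⟨L', hL', hprod_eq.trans hprod', by simpa using hlength, fun u hu => ?_, hdesc⟩
  simp only [List.mem_append, List.mem_cons] at hu hmem
  rcases hu with hu | rfl | rfl | hu
  exacts [hmem u (by tauto), hpair ht_mem, hpair ht'_mem, hmem u (by tauto)]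
termination_by pathLengthSum cs w L

theorem wordProd_mem_closure (ω : List ι) :
    cs.wordProd ω ∈ Subgroup.closure (cs.simple '' {i | i ∈ ω}) :=
  list_prod_mem fun _ ht => Subgroup.subset_closure (by simpa using ht)

theorem IsDescendingPath.length_eq_and_mem_closure {ω : List ι} (hω : ω.Nodup) {L : List W}
    (hL : ∀ t ∈ L, cs.IsReflection t) (hprod : cs.wordProd ω * L.prod = 1)
    (hdesc : IsDescendingPath cs (cs.wordProd ω) L) :
    L.length = ω.length ∧ ∀ t ∈ L, t ∈ Subgroup.closure (cs.simple '' {i | i ∈ ω}) := by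
  induction L generalizing ω with
  | nil =>
    rw [List.prod_nil, mul_one] at hprod
    simp [eq_nil_of_wordProd_eq_one cs ω hω hprod]
  | cons t L ih =>
    obtain ⟨ht, hL⟩ := List.forall_mem_cons.mp hL
    obtain ⟨k, hk, hexchange⟩ := strong_exchange cs ⟨ht, hdesc.1⟩
    have hsub := ω.eraseIdx_sublist k
    rw [List.prod_cons, ← mul_assoc, hexchange] at hprod
    obtain ⟨hlength, hmem⟩ := ih (hω.sublist hsub) hL hprod (hexchange ▸ hdesc.2)
    have hle : Subgroup.closure (cs.simple '' {i | i ∈ ω.eraseIdx k}) ≤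
        Subgroup.closure (cs.simple '' {i | i ∈ ω}) :=
      Subgroup.closure_mono (Set.image_mono fun i hi => hsub.subset hi)
    refine ⟨?_, List.forall_mem_cons.mpr ⟨?_, fun u hu => hle (hmem u hu)⟩⟩
    · rw [List.length_cons, hlength, List.length_eraseIdx_of_lt hk]
      omega
    · rw [eq_inv_mul_of_mul_eq hexchange]
      exact mul_mem (inv_mem (wordProd_mem_closure ω)) (hle (wordProd_mem_closure _))

theorem length_eq_and_mem_closure_of_prod_eq_wordProd {ω : List ι} (hω : ω.Nodup) {L : List W}
    (hL : ∀ t ∈ L, cs.IsReflection t) (hprod : L.prod = cs.wordProd ω)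
    (hmin : L.length = reflectionLength cs L.prod) :
    L.length = ω.length ∧ ∀ t ∈ L, t ∈ Subgroup.closure (cs.simple '' {i | i ∈ ω}) := by
  have hreverse : cs.wordProd ω.reverse * L.prod = 1 := by
    rw [hprod, cs.wordProd_reverse, inv_mul_cancel]
  obtain ⟨L', hL', hprod', hlength', hmem, hdesc⟩ := exists_isDescendingPath L hL hreverse hmin
  obtain ⟨hlength, hmem'⟩ :=
    hdesc.length_eq_and_mem_closure (List.nodup_reverse.mpr hω) hL' (hprod' ▸ hreverse)
  simp only [List.length_reverse, List.mem_reverse] at hlength hmem'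
  exact ⟨hlength' ▸ hlength, fun t ht => (Subgroup.closure_le _).mpr hmem' (hmem t ht)⟩

theorem reflectionLength_wordProd {ω : List ι} (hω : ω.Nodup) :
    reflectionLength cs (cs.wordProd ω) = ω.length := by
  obtain ⟨L, hlength, hL, hprod⟩ := exists_length_eq_reflectionLength cs (cs.wordProd ω)
  rw [← hlength]
  exact (length_eq_and_mem_closure_of_prod_eq_wordProd hω hL hprod (hprod ▸ hlength)).1

theorem mem_closure_of_reflectionLength_mul_lt {ω : List ι} (hω : ω.Nodup) {t : W}
    (ht : cs.IsReflection t) (hlt : reflectionLength cs (t * cs.wordProd ω) < ω.length) :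
    t ∈ Subgroup.closure (cs.simple '' {i | i ∈ ω}) := by
  obtain ⟨L, hlength, hL, hprod⟩ := exists_length_eq_reflectionLength cs (t * cs.wordProd ω)
  have hcons : (t :: L).prod = cs.wordProd ω := by
    rw [List.prod_cons, hprod, ← mul_assoc, ht.mul_self, one_mul]
  have htL : ∀ u ∈ t :: L, cs.IsReflection u := List.forall_mem_cons.mpr ⟨ht, hL⟩
  have hmin : (t :: L).length = reflectionLength cs (t :: L).prod := by
    refine le_antisymm ?_ (reflectionLength_prod_le htL)
    rw [hcons, reflectionLength_wordProd hω, List.length_cons, hlength]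
    exact hlt
  exact (length_eq_and_mem_closure_of_prod_eq_wordProd hω htL hcons hmin).2 t (by simp)

end ReflectionFactorizations

section ReflectionGroups

variable {E : Type*} [NormedAddCommGroup E] [InnerProductSpace ℝ E]

/-- The orthogonal reflection that negates `a` and fixes the hyperplane orthogonal to `a`. -/
noncomputable abbrev orthReflection (a : E) : E ≃ₗᵢ[ℝ] E := (Submodule.span ℝ {a})ᗮ.reflection

theorem orthReflection_apply_of_norm_eq_one {a : E} (ha : ‖a‖ = 1) (v : E) :
    orthReflection a v = v - (2 * inner ℝ a v) • a := by
  rw [orthReflection, Submodule.reflection_orthogonal_apply, Submodule.reflection_singleton_apply]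
  simp only [RCLike.ofReal_real_eq_id, id, ha, one_pow, div_one]
  module

theorem orthReflection_apply_eq_self_iff {a v : E} : orthReflection a v = v ↔ inner ℝ a v = 0 := by
  rw [orthReflection, Submodule.reflection_eq_self_iff,
    Submodule.mem_orthogonal_singleton_iff_inner_right]

theorem orthReflection_apply_self (a : E) : orthReflection a a = -a :=
  Submodule.reflection_orthogonalComplement_singleton_eq_neg a

theorem orthReflection_mul_self (a : E) : orthReflection a * orthReflection a = 1 :=
  Submodule.reflection_mul_reflection _

theorem orthReflection_smul {c : ℝ} (hc : c ≠ 0) (a : E) :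
    orthReflection (c • a) = orthReflection a := by
  ext v
  simp only [orthReflection, Submodule.span_singleton_smul_eq hc.isUnit a]

theorem orthReflection_map (u : E ≃ₗᵢ[ℝ] E) (a : E) :
    orthReflection (u a) = u * orthReflection a * u⁻¹ := by
  have hmap : (Submodule.span ℝ {u a})ᗮ =
      (Submodule.span ℝ {a})ᗮ.map (u.toLinearEquiv : E →ₗ[ℝ] E) := by
    rw [Submodule.map_orthogonal_equiv, Submodule.map_span, Set.image_singleton]
    rfl
  ext v
  simp only [orthReflection, hmap]
  exact Submodule.reflection_map_apply u _ v

/-- A unit root system: a finite set of unit vectors closed under the reflections in its members.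
Neither spanning nor integrality is required. -/
structure IsUnitRootSystem (Φ : Set E) : Prop where
  finite : Φ.Finite
  norm_eq_one : ∀ a ∈ Φ, ‖a‖ = 1
  reflection_mem : ∀ a ∈ Φ, ∀ b ∈ Φ, orthReflection a b ∈ Φ

/-- The simple roots for the chamber containing `x`, encoded as those positive roots `a` whose
reflection sends every other positive root to a positive root. -/
def simpleRoots (Φ : Set E) (x : E) : Set E :=
  {a ∈ Φ | 0 < inner ℝ a x ∧
    ∀ b ∈ Φ, 0 < inner ℝ b x → b ≠ a → 0 < inner ℝ (orthReflection a b) x}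

theorem simpleRoots_subset (Φ : Set E) (x : E) : simpleRoots Φ x ⊆ Φ := fun _ ha => ha.1

theorem prod_map_orthReflection_mem_closure {D : Set E} {L : List E} (hL : ∀ a ∈ L, a ∈ D) :
    (L.map orthReflection).prod ∈ Subgroup.closure (orthReflection '' D) :=
  Subgroup.list_prod_mem _ <| List.forall_mem_map.mpr fun a ha =>
    Subgroup.subset_closure ⟨a, hL a ha, rfl⟩

theorem exists_prod_map_orthReflection_eq {D : Set E} {w : E ≃ₗᵢ[ℝ] E}
    (hw : w ∈ Subgroup.closure (orthReflection '' D)) :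
    ∃ L : List E, (∀ a ∈ L, a ∈ D) ∧ (L.map orthReflection).prod = w := by
  have cons {d : E} (hd : d ∈ D) {u : E ≃ₗᵢ[ℝ] E}
      (hu : ∃ L : List E, (∀ a ∈ L, a ∈ D) ∧ (L.map orthReflection).prod = u) :
      ∃ L : List E, (∀ a ∈ L, a ∈ D) ∧ (L.map orthReflection).prod = orthReflection d * u := by
    obtain ⟨L, hL, rfl⟩ := hu
    exact ⟨d :: L, List.forall_mem_cons.mpr ⟨hd, hL⟩, by rw [List.map_cons, List.prod_cons]⟩
  induction hw using Subgroup.closure_induction_left with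
  | one => exact ⟨[], by simp, by simp⟩
  | mul_left g hg u _ ih =>
    obtain ⟨d, hd, rfl⟩ := hg
    exact cons hd ih
  | inv_mul_cancel g hg u _ ih =>
    obtain ⟨d, hd, rfl⟩ := hg
    rw [Submodule.reflection_inv]
    exact cons hd ih

namespace IsUnitRootSystem

variable {Φ : Set E} (hΦ : IsUnitRootSystem Φ)

include hΦ

theorem neg_mem {a : E} (ha : a ∈ Φ) : -a ∈ Φ :=
  orthReflection_apply_self a ▸ hΦ.reflection_mem a ha a ha

theorem closure_apply_mem {w : E ≃ₗᵢ[ℝ] E} (hw : w ∈ Subgroup.closure (orthReflection '' Φ))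
    {a : E} (ha : a ∈ Φ) : w a ∈ Φ := by
  obtain ⟨L, hL, rfl⟩ := exists_prod_map_orthReflection_eq hw
  induction L with
  | nil => exact ha
  | cons d L ih =>
    obtain ⟨hd, hL⟩ := List.forall_mem_cons.mp hL
    exact hΦ.reflection_mem d hd _ (ih hL (prod_map_orthReflection_mem_closure hL))

variable {x : E}

/-- If `orthReflection a` sends the positive root `b` to a negative root, then `b` and
`-orthReflection a b` are positive roots with sum `2⟪a, b⟫ • a`, so that one of them has height
at most `⟪a, b⟫ * ⟪a, x⟫`. -/
theorem exists_abs_inner_lt_of_notMem_simpleRoots (hx : ∀ a ∈ Φ, inner ℝ a x ≠ 0) {a : E}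
    (ha : a ∈ Φ) (hax : 0 < inner ℝ a x) (has : a ∉ simpleRoots Φ x) :
    ∃ b ∈ Φ, |inner ℝ b x| < inner ℝ a x ∧ |inner ℝ (orthReflection b a) x| < inner ℝ a x := by
  have hna := hΦ.norm_eq_one a ha
  obtain ⟨b, hb, hbx, hlt, hle⟩ : ∃ b ∈ Φ, 0 < inner ℝ b x ∧ inner ℝ a b < 1 ∧
      inner ℝ b x ≤ inner ℝ a b * inner ℝ a x := by
    simp only [simpleRoots, Set.mem_ofPred_eq, ha, hax, true_and, not_forall, not_lt] at has
    obtain ⟨b, hb, hbx, hba, hneg⟩ := has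
    have hlt : inner ℝ a b < 1 :=
      (inner_lt_one_iff_real_of_norm_eq_one hna (hΦ.norm_eq_one b hb)).mpr hba.symm
    have hsb := hΦ.reflection_mem a ha b hb
    have hneg : inner ℝ (orthReflection a b) x < 0 := hneg.lt_of_ne (hx _ hsb)
    rcases le_total (inner ℝ b x) (inner ℝ a b * inner ℝ a x) with hle | hle
    · exact ⟨b, hb, hbx, hlt, hle⟩
    have hinner : inner ℝ a (-orthReflection a b) = inner ℝ a b := by
      rw [← (orthReflection a).inner_map_map a b, orthReflection_apply_self, inner_neg_left,
        inner_neg_right]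
    refine ⟨-orthReflection a b, hΦ.neg_mem hsb, by simpa using hneg, hinner ▸ hlt, ?_⟩
    rw [hinner, orthReflection_apply_of_norm_eq_one hna, inner_neg_left, inner_sub_left,
      real_inner_smul_left]
    linarith
  have hpos : 0 < inner ℝ a b := pos_of_mul_pos_left (hbx.trans_le hle) hax.le
  refine ⟨b, hb, ?_, ?_⟩
  · rw [abs_of_pos hbx]
    nlinarith [hpos]
  · rw [orthReflection_apply_of_norm_eq_one (hΦ.norm_eq_one b hb), inner_sub_left,
      real_inner_smul_left, real_inner_comm a b, abs_lt]
    constructor <;> nlinarith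

theorem orthReflection_mem_closure_simpleRoots (hx : ∀ a ∈ Φ, inner ℝ a x ≠ 0) {a : E}
    (ha : a ∈ Φ) : orthReflection a ∈ Subgroup.closure (orthReflection '' simpleRoots Φ x) := by
  set N := Subgroup.closure (orthReflection '' simpleRoots Φ x)
  by_contra haN
  obtain ⟨a, ⟨ha, haN⟩, hmin⟩ := Set.exists_min_image {a ∈ Φ | orthReflection a ∉ N}
    (fun a => |inner ℝ a x|) (hΦ.finite.subset fun a ha => ha.1) ⟨a, ha, haN⟩
  wlog hax : 0 < inner ℝ a x generalizing a
  · have hneg : orthReflection (-a) = orthReflection a := by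
      rw [← neg_one_smul ℝ, orthReflection_smul (by norm_num)]
    refine this (-a) (fun b hb => ?_) (hΦ.neg_mem ha) (by rwa [hneg]) ?_
    · simpa using hmin b hb
    · simpa using (not_lt.mp hax).lt_of_ne (hx a ha)
  have mem_of_lt {b : E} (hb : b ∈ Φ) (hlt : |inner ℝ b x| < inner ℝ a x) :
      orthReflection b ∈ N := by
    by_contra hbN
    exact (hmin b ⟨hb, hbN⟩).not_gt (by rwa [abs_of_pos hax])
  have has : a ∉ simpleRoots Φ x := fun has => haN (Subgroup.subset_closure ⟨a, has, rfl⟩)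
  obtain ⟨b, hb, hbx, hbax⟩ := hΦ.exists_abs_inner_lt_of_notMem_simpleRoots hx ha hax has
  have hbN := mem_of_lt hb hbx
  have hconj : orthReflection a =
      orthReflection b * orthReflection (orthReflection b a) * orthReflection b := by
    rw [orthReflection_map, Submodule.reflection_inv]
    simp only [← mul_assoc, orthReflection_mul_self, one_mul]
    rw [mul_assoc, orthReflection_mul_self, mul_one]
  rw [hconj] at haN
  exact haN (mul_mem (mul_mem hbN (mem_of_lt (hΦ.reflection_mem b hb a ha) hbax)) hbN)

theorem exchange (hx : ∀ a ∈ Φ, inner ℝ a x ≠ 0) {a : E} (ha : a ∈ Φ) (L : List E)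
    (hL : ∀ d ∈ L, d ∈ simpleRoots Φ x) (hax : 0 < inner ℝ a x)
    (hneg : inner ℝ ((L.map orthReflection).prod a) x < 0) :
    ∃ L' : List E, (∀ d ∈ L', d ∈ simpleRoots Φ x) ∧ L'.length + 1 = L.length ∧
      (L.map orthReflection).prod * orthReflection a = (L'.map orthReflection).prod := by
  induction L with
  | nil => exact absurd hax hneg.not_gt
  | cons d L ih =>
    obtain ⟨hd, hL⟩ := List.forall_mem_cons.mp hL
    set w := (L.map orthReflection).prod with hw
    have hwa : w a ∈ Φ := hΦ.closure_apply_mem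
      (prod_map_orthReflection_mem_closure fun d hd => (hL d hd).1) ha
    rw [List.map_cons, List.prod_cons, ← hw] at hneg ⊢
    rcases lt_or_gt_of_ne (hx _ hwa) with hwax | hwax
    · obtain ⟨L', hL', hlen, hprod⟩ := ih hL hwax
      exact ⟨d :: L', List.forall_mem_cons.mpr ⟨hd, hL'⟩, by simp only [List.length_cons, hlen],
        by rw [List.map_cons, List.prod_cons, mul_assoc, hprod]⟩
    · have hwad : w a = d := by
        by_contra hne
        exact (hd.2.2 (w a) hwa hwax hne).not_gt hneg
      refine ⟨L, hL, rfl, ?_⟩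
      rw [← hw, ← hwad, orthReflection_map]
      simp only [mul_assoc, inv_mul_cancel_left]
      rw [orthReflection_mul_self, mul_one]

theorem eq_one_of_apply_eq (hx : ∀ a ∈ Φ, inner ℝ a x ≠ 0) {w : E ≃ₗᵢ[ℝ] E}
    (hw : w ∈ Subgroup.closure (orthReflection '' Φ)) (hwx : w x = x) : w = 1 := by
  have hwD : w ∈ Subgroup.closure (orthReflection '' simpleRoots Φ x) :=
    (Subgroup.closure_le _).mpr (Set.image_subset_iff.mpr fun _ ha =>
      hΦ.orthReflection_mem_closure_simpleRoots hx ha) hw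
  obtain ⟨L, hL, hLw⟩ := exists_prod_map_orthReflection_eq hwD
  clear hw hwD
  induction hlen : L.length using Nat.strong_induction_on generalizing L with
  | _ k ih =>
  subst hlen
  rcases List.eq_nil_or_concat' L with rfl | ⟨L, a, rfl⟩
  · exact hLw.symm
  simp only [List.forall_mem_append, List.forall_mem_singleton] at hL
  obtain ⟨hL, ha⟩ := hL
  rw [List.map_append, List.prod_append, List.map_singleton, List.prod_singleton] at hLw
  set u := (L.map orthReflection).prod
  have hwa : w a = -u a := by
    rw [← hLw, ← map_neg, ← orthReflection_apply_self]
    rfl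
  have hneg : inner ℝ (u a) x < 0 := by
    have hinner := w.inner_map_map a x
    rw [hwx, hwa, inner_neg_left] at hinner
    linarith [ha.2.1]
  obtain ⟨L', hL', hlen, hprod⟩ := hΦ.exchange hx ha.1 L hL ha.2.1 hneg
  exact ih L'.length (by simp only [List.length_append, List.length_singleton]; omega) L' hL'
    (hprod.symm.trans hLw) rfl

end IsUnitRootSystem

/-- The subspace of vectors fixed by an isometry. -/
def fixedSpace (w : E ≃ₗᵢ[ℝ] E) : Submodule ℝ E :=
  LinearMap.eqLocus (w.toLinearEquiv : E →ₗ[ℝ] E) LinearMap.id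

theorem mem_fixedSpace {w : E ≃ₗᵢ[ℝ] E} {v : E} : v ∈ fixedSpace w ↔ w v = v := Iff.rfl

theorem exists_mem_orthogonal_fixedSpace {Φ : Set E} (hΦ : IsUnitRootSystem Φ) {w : E ≃ₗᵢ[ℝ] E}
    (hw : w ∈ Subgroup.closure (orthReflection '' Φ)) (hw1 : w ≠ 1) :
    ∃ a ∈ Φ, a ∈ (fixedSpace w)ᗮ := by
  -- A finite union of proper subspaces does not cover `fixedSpace w`.
  by_contra! hcon
  have := hΦ.finite.to_subtype
  let mirrorIn (a : Φ) : Submodule ℝ (fixedSpace w) :=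
    (Submodule.span ℝ {(a : E)})ᗮ.comap (fixedSpace w).subtype
  obtain ⟨x, hx⟩ : ∃ x, x ∉ ⋃ a, (mirrorIn a : Set (fixedSpace w)) := by
    rw [← Set.ne_univ_iff_exists_notMem]
    intro hcover
    obtain ⟨⟨a, ha⟩, htop⟩ := Subspace.exists_eq_top_of_iUnion_eq_univ hcover
    refine hcon a ha ((Submodule.mem_orthogonal' _ _).mpr fun v hv => ?_)
    have hmem : (⟨v, hv⟩ : fixedSpace w) ∈ mirrorIn ⟨a, ha⟩ := htop ▸ Submodule.mem_top
    exact Submodule.mem_orthogonal_singleton_iff_inner_right.mp hmem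
  refine hw1 (hΦ.eq_one_of_apply_eq (fun a ha hax => hx ?_) hw x.2)
  exact Set.mem_iUnion.mpr
    ⟨⟨a, ha⟩, Submodule.mem_orthogonal_singleton_iff_inner_right.mpr hax⟩

variable [FiniteDimensional ℝ E]

theorem exists_apply_sub_eq_of_mem_orthogonal_fixedSpace {w : E ≃ₗᵢ[ℝ] E} {b : E}
    (hb : b ∈ (fixedSpace w)ᗮ) : ∃ u, w u - u = b := by
  let R := LinearMap.range ((w.toLinearEquiv : E →ₗ[ℝ] E) - LinearMap.id)
  suffices hle : Rᗮ ≤ fixedSpace w by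
    have hbR : b ∈ Rᗮᗮ := Submodule.orthogonal_le hle hb
    rwa [Submodule.orthogonal_orthogonal] at hbR
  intro v hv
  have hvR (u : E) : inner ℝ (w u - u) v = 0 := hv _ ⟨u, rfl⟩
  have hv0 := hvR v
  rw [inner_sub_left, sub_eq_zero] at hv0
  rw [mem_fixedSpace, ← sub_eq_zero, ← inner_self_eq_zero (𝕜 := ℝ), inner_sub_left,
    inner_sub_right, inner_sub_right, w.inner_map_map, real_inner_comm (w v) v, hv0]
  ring

theorem fixedSpace_lt_fixedSpace_orthReflection_mul {w : E ≃ₗᵢ[ℝ] E} {b : E} (hb0 : b ≠ 0)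
    (hb : b ∈ (fixedSpace w)ᗮ) : fixedSpace w < fixedSpace (orthReflection b * w) := by
  obtain ⟨u, rfl⟩ := exists_apply_sub_eq_of_mem_orthogonal_fixedSpace hb
  refine SetLike.lt_iff_le_and_exists.mpr ⟨fun v hv => ?_, u, ?_, ?_⟩
  · change orthReflection (w u - u) (w v) = v
    rw [mem_fixedSpace.mp hv, orthReflection_apply_eq_self_iff]
    exact (Submodule.mem_orthogonal' _ _).mp hb v hv
  · exact Submodule.reflection_sub (w.norm_map u)
  · exact fun hu => hb0 (sub_eq_zero.mpr hu)

theorem exists_orthReflection_factorization {Φ : Set E} (hΦ : IsUnitRootSystem Φ)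
    {w : E ≃ₗᵢ[ℝ] E} (hw : w ∈ Subgroup.closure (orthReflection '' Φ)) :
    ∃ L : List E, (∀ a ∈ L, a ∈ Φ ∧ a ∈ (fixedSpace w)ᗮ) ∧ (L.map orthReflection).prod = w ∧
      L.length + Module.finrank ℝ (fixedSpace w) ≤ Module.finrank ℝ E := by
  induction hF : fixedSpace w using WellFoundedGT.induction generalizing w with
  | _ F ih =>
  subst hF
  rcases eq_or_ne w 1 with rfl | hw1
  · exact ⟨[], by simp, by simp, by simpa using Submodule.finrank_le _⟩
  obtain ⟨a, ha, haF⟩ := exists_mem_orthogonal_fixedSpace hΦ hw hw1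
  have ha0 : a ≠ 0 := norm_ne_zero_iff.mp (by rw [hΦ.norm_eq_one a ha]; exact one_ne_zero)
  have hlt := fixedSpace_lt_fixedSpace_orthReflection_mul ha0 haF
  obtain ⟨L, hL, hLw, hlen⟩ :=
    ih _ hlt (mul_mem (Subgroup.subset_closure ⟨a, ha, rfl⟩) hw) rfl
  refine ⟨a :: L, List.forall_mem_cons.mpr ⟨⟨ha, haF⟩, fun b hb => ?_⟩, ?_, ?_⟩
  · exact ⟨(hL b hb).1, Submodule.orthogonal_le hlt.le (hL b hb).2⟩
  · rw [List.map_cons, List.prod_cons, hLw, ← mul_assoc, orthReflection_mul_self, one_mul]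
  · have := Submodule.finrank_lt_finrank_of_lt hlt
    rw [List.length_cons]
    omega

end ReflectionGroups

namespace FiniteCoxeterReflectionGroup

variable {n : ℕ} (G : FiniteCoxeterReflectionGroup n)

theorem coe_simple (i : Fin n) : (G.cs.simple i : OrthGroup n) = orthReflection (G.normal i) :=
  G.simple_eq i

/-- The unit normals of the mirrors of `G`, as images of the normalised simple normals. -/
def roots : Set (EuclideanSpace ℝ (Fin n)) :=
  Set.range fun p : G.W × Fin n => (p.1 : OrthGroup n) (‖G.normal p.2‖⁻¹ • G.normal p.2)

theorem orthReflection_root (w : G.W) (i : Fin n) :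
    orthReflection ((w : OrthGroup n) (‖G.normal i‖⁻¹ • G.normal i)) =
      ((w * G.cs.simple i * w⁻¹ : G.W) : OrthGroup n) := by
  rw [orthReflection_map, orthReflection_smul (by simpa using G.normal_ne_zero i), ← G.coe_simple]
  rfl

theorem exists_isReflection_coe_eq {a : EuclideanSpace ℝ (Fin n)} (ha : a ∈ G.roots) :
    ∃ t, G.cs.IsReflection t ∧ (t : OrthGroup n) = orthReflection a := by
  obtain ⟨⟨w, i⟩, rfl⟩ := ha
  exact ⟨_, ⟨w, i, rfl⟩, (G.orthReflection_root w i).symm⟩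

theorem isUnitRootSystem_roots : IsUnitRootSystem G.roots where
  finite := by
    have := G.finite
    exact Set.finite_range _
  norm_eq_one := by
    rintro _ ⟨⟨w, i⟩, rfl⟩
    simp [norm_smul, G.normal_ne_zero i]
  reflection_mem := by
    rintro _ ⟨⟨w, i⟩, rfl⟩ _ ⟨⟨u, j⟩, rfl⟩
    simp only
    rw [orthReflection_root]
    exact ⟨(w * G.cs.simple i * w⁻¹ * u, j), rfl⟩

theorem coe_mem_closure_roots (w : G.W) :
    (w : OrthGroup n) ∈ Subgroup.closure (orthReflection '' G.roots) := by
  induction w using G.cs.simple_induction_left with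
  | one => exact one_mem _
  | mul_simple_left w i ih =>
    refine mul_mem (Subgroup.subset_closure ⟨_, ⟨(1, i), rfl⟩, ?_⟩) ih
    simp only
    rw [orthReflection_root, one_mul, inv_one, mul_one]

theorem exists_reflection_factorization (w : G.W) :
    ∃ L : List G.W, (∀ t ∈ L, G.cs.IsReflection t ∧ ∃ a ∈ (fixedSpace (w : OrthGroup n))ᗮ,
      a ≠ 0 ∧ (t : OrthGroup n) = orthReflection a) ∧ L.prod = w ∧
      L.length + Module.finrank ℝ (fixedSpace (w : OrthGroup n)) ≤ n := by
  obtain ⟨L, hL, hLw, hlen⟩ :=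
    exists_orthReflection_factorization G.isUnitRootSystem_roots (G.coe_mem_closure_roots w)
  choose! t ht ht_coe using fun a (ha : a ∈ G.roots) => G.exists_isReflection_coe_eq ha
  refine ⟨L.map t, List.forall_mem_map.mpr fun a ha => ?_, Subtype.ext ?_, ?_⟩
  · obtain ⟨haΦ, haw⟩ := hL a ha
    have ha0 : a ≠ 0 := norm_ne_zero_iff.mp (by
      rw [G.isUnitRootSystem_roots.norm_eq_one a haΦ]
      exact one_ne_zero)
    exact ⟨ht a haΦ, a, haw, ha0, ht_coe a haΦ⟩
  · rw [← hLw, Subgroup.val_list_prod, List.map_map]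
    exact congrArg List.prod (List.map_congr_left fun a ha => ht_coe a (hL a ha).1)
  · simpa using hlen

theorem reflectionLength_add_finrank_fixedSpace_le (w : G.W) :
    reflectionLength G.cs w + Module.finrank ℝ (fixedSpace (w : OrthGroup n)) ≤ n := by
  obtain ⟨L, hL, rfl, hlen⟩ := G.exists_reflection_factorization w
  have := reflectionLength_prod_le fun t ht => (hL t ht).1
  omega

/-- The intersection of the mirrors `H_i` with `i ∈ I`, encoded as an orthogonal complement for
the sake of dimension counts. -/
noncomputable def commonMirror (I : Finset (Fin n)) : Submodule ℝ (EuclideanSpace ℝ (Fin n)) :=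
  (Submodule.span ℝ (G.normal '' I))ᗮ

variable {I : Finset (Fin n)} {v : EuclideanSpace ℝ (Fin n)}

theorem mem_commonMirror : v ∈ G.commonMirror I ↔ ∀ i ∈ I, inner ℝ (G.normal i) v = 0 := by
  rw [commonMirror, ← SetLike.mem_coe, ← Set.singleton_subset_iff, ← Submodule.span_le,
    ← Submodule.isOrtho_iff_le, Submodule.isOrtho_span]
  simp [real_inner_comm]

theorem le_card_add_finrank_commonMirror (I : Finset (Fin n)) :
    n ≤ I.card + Module.finrank ℝ (G.commonMirror I) := by
  have hspan : Module.finrank ℝ (Submodule.span ℝ (G.normal '' I)) ≤ I.card := by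
    classical
    rw [← Finset.coe_image]
    exact (finrank_span_finset_le_card _).trans Finset.card_image_le
  have hadd := (Submodule.span ℝ (G.normal '' I)).finrank_add_finrank_orthogonal
  rw [finrank_euclideanSpace_fin] at hadd
  rw [commonMirror]
  omega

theorem apply_eq_self_of_mem_parabolic {w : G.W} (hw : w ∈ G.parabolic I)
    (hv : v ∈ G.commonMirror I) : (w : OrthGroup n) v = v := by
  induction hw using Subgroup.closure_induction with
  | mem _ h =>
    obtain ⟨i, hi, rfl⟩ := h
    rw [G.coe_simple, orthReflection_apply_eq_self_iff]
    exact G.mem_commonMirror.mp hv i hi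
  | one => rfl
  | mul u w _ _ hu hw => exact (congrArg (u : OrthGroup n) hw).trans hu
  | inv u _ hu => exact (u : OrthGroup n).symm_apply_eq.mpr hu.symm

theorem wordProd_toList_mem_parabolic (I : Finset (Fin n)) :
    G.cs.wordProd I.toList ∈ G.parabolic I := by
  simpa [parabolic] using wordProd_mem_closure (cs := G.cs) I.toList

theorem fixedSpace_wordProd_toList (I : Finset (Fin n)) :
    fixedSpace (G.cs.wordProd I.toList : OrthGroup n) = G.commonMirror I := by
  refine (Submodule.eq_of_le_of_finrank_le (fun v hv =>
    G.apply_eq_self_of_mem_parabolic (G.wordProd_toList_mem_parabolic I) hv) ?_).symm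
  have hle := G.reflectionLength_add_finrank_fixedSpace_le (G.cs.wordProd I.toList)
  rw [reflectionLength_wordProd I.nodup_toList, Finset.length_toList] at hle
  have := G.le_card_add_finrank_commonMirror I
  omega

theorem card_add_finrank_commonMirror (I : Finset (Fin n)) :
    I.card + Module.finrank ℝ (G.commonMirror I) = n := by
  have hle := G.reflectionLength_add_finrank_fixedSpace_le (G.cs.wordProd I.toList)
  rw [reflectionLength_wordProd I.nodup_toList, Finset.length_toList,
    G.fixedSpace_wordProd_toList] at hle
  exact hle.antisymm (G.le_card_add_finrank_commonMirror I)

theorem mem_parabolic_of_isReflection {t : G.W} (ht : G.cs.IsReflection t)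
    {a : EuclideanSpace ℝ (Fin n)} (ha0 : a ≠ 0) (ha : a ∈ (G.commonMirror I)ᗮ)
    (hta : (t : OrthGroup n) = orthReflection a) : t ∈ G.parabolic I := by
  have hlt := Submodule.finrank_lt_finrank_of_lt (fixedSpace_lt_fixedSpace_orthReflection_mul ha0
    (G.fixedSpace_wordProd_toList I ▸ ha))
  rw [← hta, G.fixedSpace_wordProd_toList, ← Subgroup.coe_mul] at hlt
  have hle := G.reflectionLength_add_finrank_fixedSpace_le (t * G.cs.wordProd I.toList)
  have hcard := G.card_add_finrank_commonMirror I
  have hmem := mem_closure_of_reflectionLength_mul_lt I.nodup_toList ht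
    (by rw [Finset.length_toList]; omega)
  simpa [parabolic] using hmem

theorem mem_parabolic_iff {w : G.W} :
    w ∈ G.parabolic I ↔ ∀ v ∈ G.commonMirror I, (w : OrthGroup n) v = v := by
  refine ⟨fun hw v hv => G.apply_eq_self_of_mem_parabolic hw hv, fun hw => ?_⟩
  have hle : G.commonMirror I ≤ fixedSpace (w : OrthGroup n) := hw
  obtain ⟨L, hL, rfl, -⟩ := G.exists_reflection_factorization w
  refine Subgroup.list_prod_mem _ fun t ht => ?_
  obtain ⟨ht, a, ha, ha0, hta⟩ := hL t ht
  exact G.mem_parabolic_of_isReflection ht ha0 (Submodule.orthogonal_le hle ha) hta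

theorem mem_facet :
    v ∈ G.facet I ↔ v ∈ G.commonMirror I ∧ ∀ i ∉ I, 0 < inner ℝ (G.normal i) v := by
  rw [facet, Set.mem_iInter, mem_commonMirror, ← forall_and]
  refine forall_congr' fun i => ?_
  by_cases hi : i ∈ I
  · simp [hi, mirror, Submodule.mem_orthogonal_singleton_iff_inner_right]
  · simp [hi, posHalfSpace]

theorem facet_nonempty (I : Finset (Fin n)) : (G.facet I).Nonempty := by
  classical
  let pairing : EuclideanSpace ℝ (Fin n) →ₗ[ℝ] (Fin n → ℝ) :=
    LinearMap.pi fun i => (innerSL ℝ (G.normal i)).toLinearMap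
  have hbot : G.commonMirror Finset.univ = ⊥ := by
    have hcard := G.card_add_finrank_commonMirror Finset.univ
    rw [Finset.card_univ, Fintype.card_fin] at hcard
    exact Submodule.finrank_eq_zero.mp (by omega)
  have hinj : Function.Injective pairing := by
    refine (injective_iff_map_eq_zero pairing).mpr fun v hv => ?_
    rw [← Submodule.mem_bot ℝ, ← hbot, mem_commonMirror]
    exact fun i _ => congrFun hv i
  obtain ⟨x, hx⟩ := (LinearMap.injective_iff_surjective_of_finrank_eq_finrank (by simp)).mp hinj
    fun i => if i ∈ I then 0 else 1
  have hx (i) : inner ℝ (G.normal i) x = if i ∈ I then 0 else 1 := congrFun hx i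
  refine ⟨x, G.mem_facet.mpr ⟨G.mem_commonMirror.mpr fun i hi => ?_, fun i hi => ?_⟩⟩
  · rw [hx, if_pos hi]
  · rw [hx, if_neg hi]
    exact one_pos

theorem exists_inner_normal_pos_of_mem_facet (hI : I.card + 1 = n) :
    ∃ i, ∀ v ∈ G.facet I, 0 < inner ℝ (G.normal i) v := by
  obtain ⟨i, -, hi⟩ : ∃ i ∈ Finset.univ, i ∉ I :=
    Finset.exists_mem_notMem_of_card_lt_card (by rw [Finset.card_univ, Fintype.card_fin]; omega)
  exact ⟨i, fun v hv => (G.mem_facet.mp hv).2 i hi⟩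

theorem exists_smul_eq_of_mem_commonMirror (hI : I.card + 1 = n) {x : EuclideanSpace ℝ (Fin n)}
    (hx : x ∈ G.facet I) (hv : v ∈ G.commonMirror I) : ∃ c : ℝ, c • x = v := by
  obtain ⟨i, hi⟩ := G.exists_inner_normal_pos_of_mem_facet hI
  have hx0 : x ≠ 0 := by
    rintro rfl
    simpa using hi 0 hx
  have hfinrank : Module.finrank ℝ (G.commonMirror I) = 1 := by
    have := G.card_add_finrank_commonMirror I
    omega
  obtain ⟨c, hc⟩ := (finrank_eq_one_iff_of_nonzero'
    (⟨x, (G.mem_facet.mp hx).1⟩ : G.commonMirror I) (by simpa using hx0)).mp hfinrank ⟨v, hv⟩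
  exact ⟨c, congrArg Subtype.val hc⟩

theorem eq_of_mem_facet_of_norm_eq (hI : I.card + 1 = n) {x y : EuclideanSpace ℝ (Fin n)}
    (hx : x ∈ G.facet I) (hy : y ∈ G.facet I) (hxy : ‖x‖ = ‖y‖) : x = y := by
  obtain ⟨i, hi⟩ := G.exists_inner_normal_pos_of_mem_facet hI
  obtain ⟨c, rfl⟩ := G.exists_smul_eq_of_mem_commonMirror hI hx (G.mem_facet.mp hy).1
  have hc : 0 < c := by
    have hcx := hi _ hy
    rw [real_inner_smul_right] at hcx
    exact pos_of_mul_pos_left hcx (hi x hx).le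
  have hx0 : ‖x‖ ≠ 0 := by
    rw [norm_ne_zero_iff]
    rintro rfl
    simpa using hi 0 hx
  rw [norm_smul, Real.norm_of_nonneg hc.le, right_eq_mul₀ hx0] at hxy
  rw [hxy, one_smul]

end FiniteCoxeterReflectionGroup

theorem mainTheorem6 (n : ℕ) (G : FiniteCoxeterReflectionGroup n) (I : Finset (Fin n))
    (hI : I.card + 1 = n) :
    G.stab (G.facet I) = G.parabolic I := by
  ext w
  rw [G.mem_parabolic_iff]
  constructor
  · intro (hw : (w : OrthGroup n) '' G.facet I = G.facet I) v hv
    obtain ⟨x, hx⟩ := G.facet_nonempty I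
    have hwx : (w : OrthGroup n) x ∈ G.facet I := hw ▸ Set.mem_image_of_mem _ hx
    have hfix : (w : OrthGroup n) x = x :=
      G.eq_of_mem_facet_of_norm_eq hI hwx hx ((w : OrthGroup n).norm_map x)
    obtain ⟨c, rfl⟩ := G.exists_smul_eq_of_mem_commonMirror hI hx hv
    rw [map_smul, hfix]
  · intro hw
    change (w : OrthGroup n) '' G.facet I = G.facet I
    rw [Set.image_congr fun v hv => hw v (G.mem_facet.mp hv).1, Set.image_id']
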